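/- **Theorem (Termination of ARI).** *Terms.* Fix a finite set $\Pi$ of parameters with a total order. Terms are built from a denumerable set of variables, the parameters in $\Pi$, all integer and finite decimal numbers, the unary symbols $\sin,\cos,\mathrm{s}$, the binary symbols $+,\times,\wedge$ (exponentiation), $/$, $\mathrm{sin\_n},\mathrm{cos\_n},\mathrm{pwr\_n}$, and a unary quotation symbol, written $[t]$. Let $\kappa$ be any function from terms to terms (in particular, any extension of a canonizer, i.e. of a sound arithmetic simplifier of parameter-free, quote-free terms that evaluates ground terms to numbers), and let $t{\downarrow_\kappa}$ be $t$ with every quoted term $[u]$ replaced by $[\kappa(u)]$. *Ordering.* Let $/$ be interpreted by any operation $d$ on the positive integers that is weakly monotone ($x\le x'$, $y\le y'$ imply $d(x,y)\le d(x',y')$) and weakly simple ($d(x,y)\ge x$ and $d(x,y)\ge y$). The weight of a term is: $w(v)=v$ for variables; $w(t)=1$ for parameters, numbers and quoted terms; $w(\sin x)=w(\cos x)=2^{3w(x)}$; $w(\mathrm{s}(n))=w(n)+1$; $w(x+y)=1+w(x)+w(y)$; $w(x\times y)=2w(x)w(y)$; $w(x\wedge y)=2w(x)^2w(y)$; $w(x/y)=d(w(x),w(y))$;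 $w(\mathrm{sin\_n}(n,x))=w(\mathrm{cos\_n}(n,x))=(2\cdot 2^{3w(x)}+1)^{2w(n)}$; $w(\mathrm{pwr\_n}(x,n))=(2^{w(n)}+1)^{w(x)}$. Let $X=(x_1>\dots>x_n)$ be a finite, possibly empty, list of distinct variables. Write $w(s)>w(t)$ (resp. $\ge$) if this holds for all assignments of positive integers to the variables with $x_1\ge\dots\ge x_n$. The precedence consists of the two strands $x_1>\dots>x_n$ and $\sin>\cos>\wedge>\times>+>(\text{parameters, in their order})>\text{quotation}>\text{numbers}$; all other pairs of symbols are unrelated, numbers are pairwise unrelated, and contents of quoted terms are ignored except for syntactic equality. Given a status (an order, left-to-right or right-to-left, in which the arguments of each symbol are compared), $\succ=\succ_{\mathrm{AWPO}(X)}$ is the weighted path ordering: $s\succ t$ iff $w(s)>w(t)$, or $w(s)\ge w(t)$ and either (a) $s'=t$ or $s'\succ t$ for some argument $s'$ of $s$; or (b) $s\succ t'$ for every argument $t'$ of $t$, and either the root symbol of $s$ has greater precedence than that of $t$, or the root symbols are equal and the argument tuple of $s$, in status order, is lexicographically greater than that of $t$ with respect to $\succ$. Variables count as symbols without arguments. *Rewriting.*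 For a constrained rule $l\to r\mid C$, where $C$ is a finite set of constraints $s\succ t$, and a substitution $\delta$, the instance $l\delta\to r\delta\mid C\delta$ is admissible if no variable occurs in $l\delta,r\delta$ both inside and outside quoted terms, every $[u]$ in $l\delta$ has $u$ a number or a variable, and every $[u]$ in $r\delta$ or $C\delta$ has $u$ parameter-free and quote-free. A term $t$ rewrites in one step to $s$ if some subterm occurrence of $t$ that is not inside a quoted term equals $l\delta$ for a rule and a substitution $\delta$ such that the instance is admissible and all constraints in $C\delta$ are true, and $s$ results from $t$ by replacing this occurrence with $(r\delta){\downarrow_\kappa}$. A system is terminating if there is no infinite sequence of one-step rewrites $t_0\to t_1\to t_2\to\cdots$ from any term $t_0$. *Systems.* Canon consists of the rules - $(x+y)+z\to x+(y+z)$; $\;x+y\to y+x\mid x\succ y$; $\;x+(y+z)\to y+(x+z)\mid x\succ y$; - $[0]+x\to x$; $\;[a]+[b]\to[a+b]$; $\;[a]+([b]+z)\to[a+b]+z$; $\;([a]\times x)+([b]\times x)\to[a+b]\times x$; $\;([a]\times x)+(([b]\times x)+z)\to([a+b]\times x)+z$; - $(x\times y)\times z\to x\times(y\times z)$; $\;x\times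 y\to y\times x\mid x\succ y$; $\;x\times(y\times z)\to y\times(x\times z)\mid x\succ y$; - $[0]\times x\to[0]$; $\;[a]\times[b]\to[a\times b]$; $\;[a]\times([b]\times z)\to[a\times b]\times z$; - $x\times(y+z)\to(x\times y)+(x\times z)$; $\;(y+z)\times x\to(y\times x)+(z\times x)$; - $(x\wedge y)\wedge z\to x\wedge(y\times z)$; $\;(x\wedge y)\times(x\wedge z)\to x\wedge(y+z)$; $\;(x\wedge y)\times((x\wedge z)\times v)\to(x\wedge(y+z))\times v$; - $[a]\wedge[b]\to[a\wedge b]$; $\;\mathrm{pwr\_n}(x,[0])\to[1]$; $\;\mathrm{pwr\_n}(x,\mathrm{s}(n))\to x\times\mathrm{pwr\_n}(x,n)$; $\;(x+y)\wedge[1]\to x+y$; $\;(x\times y)\wedge[a]\to(x\wedge[a])\times(y\wedge[a])$; $\;x\wedge[0]\to[1]$; - $\sin([-1]\times x)\to[-1]\times\sin x$; $\;\cos([-1]\times x)\to\cos x$; $\;\sin(x_1+x_2)\to(\sin x_1\times\cos x_2)+(\cos x_1\times\sin x_2)$; $\;\cos(x_1+x_2)\to(\cos x_1\times\cos x_2)+(([-1]\times\sin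 x_1)\times\sin x_2)$; - $\mathrm{cos\_n}(\mathrm{s}(\mathrm{s}(n)),x)\to([2]\times(\cos x\times\mathrm{cos\_n}(\mathrm{s}(n),x)))+([-1]\times\mathrm{cos\_n}(n,x))$; $\;\mathrm{sin\_n}(\mathrm{s}(\mathrm{s}(n)),x)\to(([2]\times\cos x)\times\mathrm{sin\_n}(\mathrm{s}(n),x))+([-1]\times\mathrm{sin\_n}(n,x))$; - $\sin x\wedge[2]\to[1]+([-1]\times(\cos x\wedge[2]))$; - $\mathrm{cos\_n}(\mathrm{s}([0]),x)\to\cos([1]\times x)$; $\;\mathrm{cos\_n}([0],x)\to\cos([0])$; $\;\mathrm{sin\_n}(\mathrm{s}([0]),x)\to\sin([1]\times x)$; $\;\mathrm{sin\_n}([0],x)\to\sin([0])$; $\;\sin([a])\to[\sin a]$; $\;\cos([a])\to[\cos a]$; with left-to-right status for all symbols. Simp consists of the rules - $([a]\times x)+([b]\times y)\to([b]\times y)+([a]\times x)\mid x\succ y$; $\;([a]\times x)+(([b]\times y)+z)\to([b]\times y)+(([a]\times x)+z)\mid x\succ y$; - $([a]\times x)+([b]\times x)\to[a+b]\times x$;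 $\;([a]\times x)+(([b]\times x)+z)\to([a+b]\times x)+z$; with right-to-left status for $\times$ and left-to-right status for all other symbols. Then, for every such $\Pi$, $\kappa$, $d$ and $X$ (in particular for $X$ empty), both Canon and Simp are terminating. -/

import Mathlib

namespace ARI

/-- Concrete number constants: the integers and the finite decimals. -/
def Num : Type := {q : ℚ // ∃ (n : ℤ) (k : ℕ), q = n / 10 ^ k}

/-- The integer `n` as a number constant. -/
def Num.ofInt (n : ℤ) : Num := ⟨n, n, 0, by simp⟩

/-- Unary function symbols other than the quotation symbol. -/
inductive UnOp
  | sin | cos | succ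

/-- Binary function symbols; `sinN n x`, `cosN n x` and `pwrN x n` take their arguments in this
order. -/
inductive BinOp
  | add | mul | pow | div | sinN | cosN | pwrN

/-- Terms with parameters from `P` and variables from the denumerable set `ℕ`. -/
inductive Term (P : Type*)
  | var (x : ℕ)
  | param (p : P)
  | num (c : Num)
  | quote (t : Term P)
  | un (f : UnOp) (t : Term P)
  | bin (g : BinOp) (s t : Term P)

namespace Term

variable {P : Type*}

/-- Application of a substitution. -/
def subst (δ : ℕ → Term P) : Term P → Term P
  | var x => δ x
  | param p => param p
  | num c => num c
  | quote t => quote (subst δ t)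
  | un f t => un f (subst δ t)
  | bin g s t => bin g (subst δ s) (subst δ t)

/-- All variables occurring in a term. -/
def vars : Term P → Set ℕ
  | var x => {x}
  | param _ => ∅
  | num _ => ∅
  | quote t => vars t
  | un _ t => vars t
  | bin _ s t => vars s ∪ vars t

/-- The variables occurring outside quoted terms. -/
def fgVars : Term P → Set ℕ
  | var x => {x}
  | param _ => ∅
  | num _ => ∅
  | quote _ => ∅
  | un _ t => fgVars t
  | bin _ s t => fgVars s ∪ fgVars t

/-- The variables occurring inside quoted terms. -/
def bgVars : Term P → Set ℕ
  | var _ => ∅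
  | param _ => ∅
  | num _ => ∅
  | quote t => vars t
  | un _ t => bgVars t
  | bin _ s t => bgVars s ∪ bgVars t

/-- The set of all `u` such that `quote u` occurs in the term. -/
def quoted : Term P → Set (Term P)
  | var _ => ∅
  | param _ => ∅
  | num _ => ∅
  | quote t => insert t (quoted t)
  | un _ t => quoted t
  | bin _ s t => quoted s ∪ quoted t

/-- No parameter occurs in the term. -/
def ParamFree : Term P → Prop
  | var _ => True
  | param _ => False
  | num _ => True
  | quote t => ParamFree t
  | un _ t => ParamFree t
  | bin _ s t => ParamFree s ∧ ParamFree t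

/-- No quoted term occurs in the term. -/
def QuoteFree (t : Term P) : Prop := t.quoted = ∅

/-- The term is a number or a variable. -/
def IsNumOrVar (t : Term P) : Prop := (∃ c, t = num c) ∨ ∃ x, t = var x

/-- The extension of a map `κ` on quoted terms to all terms: it is applied to the content of every
quoted term and nothing else is changed. -/
def simplify (κ : Term P → Term P) : Term P → Term P
  | var x => var x
  | param p => param p
  | num c => num c
  | quote u => quote (κ u)
  | un f t => un f (simplify κ t)
  | bin g s t => bin g (simplify κ s) (simplify κ t)

end Term

section Ordering

variable {P : Type*}

/-- The weight of a term under the assignment `α` of natural numbers to variables; `d` interprets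
division. -/
def weight (d : ℕ → ℕ → ℕ) (α : ℕ → ℕ) : Term P → ℕ
  | .var x => α x
  | .param _ => 1
  | .num _ => 1
  | .quote _ => 1
  | .un .sin t => 2 ^ (weight d α t * 3)
  | .un .cos t => 2 ^ (weight d α t * 3)
  | .un .succ t => weight d α t + 1
  | .bin .add s t => 1 + (weight d α s + weight d α t)
  | .bin .mul s t => 2 * (weight d α s * weight d α t)
  | .bin .pow s t => (weight d α s * weight d α s) * (2 * weight d α t)
  | .bin .div s t => d (weight d α s) (weight d α t)
  | .bin .sinN n x => (2 * 2 ^ (weight d α x * 3) + 1) ^ (2 * weight d α n)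
  | .bin .cosN n x => (2 * 2 ^ (weight d α x * 3) + 1) ^ (2 * weight d α n)
  | .bin .pwrN x n => (2 ^ weight d α n + 1) ^ weight d α x

/-- Weak monotonicity of a binary operation on the positive integers. -/
def WeaklyMonotone (d : ℕ → ℕ → ℕ) : Prop :=
  ∀ x x' y y', 0 < x → 0 < y → x ≤ x' → y ≤ y' → d x y ≤ d x' y'

/-- Weak simplicity of a binary operation on the positive integers. -/
def WeaklySimple (d : ℕ → ℕ → ℕ) : Prop :=
  ∀ x y, 0 < x → 0 < y → x ≤ d x y ∧ y ≤ d x y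

/-- The assignments by positive integers that respect the variable precedence
`X = (x₁ > x₂ > ⋯ > xₙ)`. -/
def Respects (X : List ℕ) (α : ℕ → ℕ) : Prop :=
  (∀ x, 0 < α x) ∧ ∀ x y, List.Sublist [x, y] X → α y ≤ α x

/-- The strict comparison of weights. -/
def WeightGT (d : ℕ → ℕ → ℕ) (X : List ℕ) (s t : Term P) : Prop :=
  ∀ α, Respects X α → weight d α t < weight d α s

/-- The non-strict comparison of weights. -/
def WeightGE (d : ℕ → ℕ → ℕ) (X : List ℕ) (s t : Term P) : Prop :=
  ∀ α, Respects X α → weight d α t ≤ weight d α s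

/-- Root symbols of terms. -/
inductive Head (P : Type*)
  | var (x : ℕ)
  | param (p : P)
  | num (c : Num)
  | quote
  | un (f : UnOp)
  | bin (g : BinOp)

/-- The root symbol of a term. -/
def Term.head : Term P → Head P
  | .var x => .var x
  | .param p => .param p
  | .num c => .num c
  | .quote _ => .quote
  | .un f _ => .un f
  | .bin g _ _ => .bin g

/-- The position in the strand `sin > cos > ^ > × > + > parameters > quote > numbers` of the
precedence, for the symbols listed in it. -/
def Head.rank : Head P → Option ℕ
  | .un .sin => some 7
  | .un .cos => some 6
  | .bin .pow => some 5
  | .bin .mul => some 4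
  | .bin .add => some 3
  | .param _ => some 2
  | .quote => some 1
  | .num _ => some 0
  | _ => none

/-- The strict precedence on root symbols: the strand above, with the given order on parameters,
and the separate strand `X`. All other pairs of symbols are unrelated. -/
inductive Prec [LinearOrder P] (X : List ℕ) : Head P → Head P → Prop
  | rank {f g : Head P} {m n : ℕ} :
      f.rank = some m → g.rank = some n → n < m → Prec X f g
  | param {p q : P} : q < p → Prec X (.param p) (.param q)
  | var {x y : ℕ} : List.Sublist [x, y] X → Prec X (.var x) (.var y)

/-- A status says for each binary symbol whether its arguments are compared from right to left. -/
abbrev Status := BinOp → Bool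

/-- Every symbol has left-to-right status. -/
def leftToRight : Status := fun _ => false

/-- Multiplication has right-to-left status, every other symbol left-to-right status. -/
def mulRightToLeft : Status
  | .mul => true
  | _ => false

/-- The arguments of the root symbol, in the order given by the status. The content of a quoted
term is opaque to the ordering: contents act as pairwise unrelated minimal constants, so they never
decide a comparison and are not listed. -/
def Term.args (σ : Status) : Term P → List (Term P)
  | .un _ t => [t]
  | .bin g s t => if σ g then [t, s] else [s, t]
  | _ => []

/-- The weighted path ordering `s ≻ t` for the weights, the precedence and the status above. -/
inductive AWPO [LinearOrder P] (d : ℕ → ℕ → ℕ) (X : List ℕ) (σ : Status) :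
    Term P → Term P → Prop
  | weight {s t : Term P} : WeightGT d X s t → AWPO d X σ s t
  | sub_eq {s t : Term P} : WeightGE d X s t → t ∈ s.args σ → AWPO d X σ s t
  | sub_gt {s t u : Term P} : WeightGE d X s t → u ∈ s.args σ → AWPO d X σ u t → AWPO d X σ s t
  | prec {s t : Term P} : WeightGE d X s t → (∀ v ∈ t.args σ, AWPO d X σ s v) →
      Prec X s.head t.head → AWPO d X σ s t
  | lex {s t a b : Term P} {l l₁ l₂ : List (Term P)} : WeightGE d X s t →
      (∀ v ∈ t.args σ, AWPO d X σ s v) → s.head = t.head →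
      s.args σ = l ++ a :: l₁ → t.args σ = l ++ b :: l₂ → AWPO d X σ a b → AWPO d X σ s t

end Ordering

section Rewriting

variable {P : Type*}

/-- A rule `lhs → rhs | cond`, where `cond` is a conjunction of ordering constraints `s ≻ t`. -/
structure Rule (P : Type*) where
  lhs : Term P
  rhs : Term P
  cond : List (Term P × Term P) := []

/-- The instance of a constrained rule under a substitution. -/
def Rule.subst (δ : ℕ → Term P) (ρ : Rule P) : Rule P where
  lhs := ρ.lhs.subst δ
  rhs := ρ.rhs.subst δ
  cond := ρ.cond.map fun c => (c.1.subst δ, c.2.subst δ)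

/-- Admissibility: no variable is both background and foreground; in the left-hand side only
numbers and variables are quoted; in the right-hand side and in the constraint only parameter-free
and quote-free terms are quoted. -/
structure Rule.Admissible (ρ : Rule P) : Prop where
  disjoint : Disjoint (ρ.lhs.bgVars ∪ ρ.rhs.bgVars) (ρ.lhs.fgVars ∪ ρ.rhs.fgVars)
  lhs_quoted : ∀ u ∈ ρ.lhs.quoted, u.IsNumOrVar
  rhs_quoted : ∀ u ∈ ρ.rhs.quoted, u.ParamFree ∧ u.QuoteFree
  cond_quoted : ∀ c ∈ ρ.cond, ∀ u ∈ c.1.quoted ∪ c.2.quoted, u.ParamFree ∧ u.QuoteFree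

/-- One-step rewriting with simplification for the rule system `R`, where constraints are evaluated
with the weighted path ordering. Quoted terms are black boxes: there is no rewriting inside them. -/
inductive Step [LinearOrder P] (d : ℕ → ℕ → ℕ) (X : List ℕ) (σ : Status)
    (κ : Term P → Term P) (R : List (Rule P)) : Term P → Term P → Prop
  | root (ρ : Rule P) (δ : ℕ → Term P) : ρ ∈ R → (ρ.subst δ).Admissible →
      (∀ c ∈ (ρ.subst δ).cond, AWPO d X σ c.1 c.2) →
      Step d X σ κ R (ρ.lhs.subst δ) ((ρ.rhs.subst δ).simplify κ)
  | un (f : UnOp) {t t' : Term P} : Step d X σ κ R t t' →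
      Step d X σ κ R (.un f t) (.un f t')
  | left (g : BinOp) {s s' : Term P} (t : Term P) : Step d X σ κ R s s' →
      Step d X σ κ R (.bin g s t) (.bin g s' t)
  | right (g : BinOp) (s : Term P) {t t' : Term P} : Step d X σ κ R t t' →
      Step d X σ κ R (.bin g s t) (.bin g s t')

/-- A relation is terminating if it has no infinite derivation. -/
def Terminating {A : Type*} (r : A → A → Prop) : Prop :=
  ¬ ∃ f : ℕ → A, ∀ n, r (f n) (f (n + 1))

end Rewriting

section Systems

variable {P : Type*}

infixl:65 " +ₜ " => Term.bin BinOp.add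
infixl:70 " *ₜ " => Term.bin BinOp.mul
infixl:75 " ^ₜ " => Term.bin BinOp.pow

/-- A quoted integer constant. -/
def qn (n : ℤ) : Term P := .quote (.num (.ofInt n))

/-- A quoted variable. -/
def qv (x : ℕ) : Term P := .quote (.var x)

/-- The rule system Canon; foreground variables are `x, y, z, v = 0, 1, 2, 3` and background
variables are `a, b = 4, 5`. -/
def canon : List (Rule P) :=
  let x : Term P := .var 0
  let y : Term P := .var 1
  let z : Term P := .var 2
  let v : Term P := .var 3
  let a : Term P := .var 4
  let b : Term P := .var 5
  let qa : Term P := qv 4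
  let qb : Term P := qv 5
  let sin : Term P → Term P := .un .sin
  let cos : Term P → Term P := .un .cos
  let s : Term P → Term P := .un .succ
  let sinN : Term P → Term P → Term P := .bin .sinN
  let cosN : Term P → Term P → Term P := .bin .cosN
  let pwrN : Term P → Term P → Term P := .bin .pwrN
  [ -- addition
    ⟨(x +ₜ y) +ₜ z, x +ₜ (y +ₜ z), []⟩,
    ⟨x +ₜ y, y +ₜ x, [(x, y)]⟩,
    ⟨x +ₜ (y +ₜ z), y +ₜ (x +ₜ z), [(x, y)]⟩,
    ⟨qn 0 +ₜ x, x, []⟩,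
    ⟨qa +ₜ qb, .quote (a +ₜ b), []⟩,
    ⟨qa +ₜ (qb +ₜ z), .quote (a +ₜ b) +ₜ z, []⟩,
    ⟨(qa *ₜ x) +ₜ (qb *ₜ x), .quote (a +ₜ b) *ₜ x, []⟩,
    ⟨(qa *ₜ x) +ₜ ((qb *ₜ x) +ₜ z), (.quote (a +ₜ b) *ₜ x) +ₜ z, []⟩,
    -- multiplication
    ⟨(x *ₜ y) *ₜ z, x *ₜ (y *ₜ z), []⟩,
    ⟨x *ₜ y, y *ₜ x, [(x, y)]⟩,
    ⟨x *ₜ (y *ₜ z), y *ₜ (x *ₜ z), [(x, y)]⟩,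
    ⟨qn 0 *ₜ x, qn 0, []⟩,
    ⟨qa *ₜ qb, .quote (a *ₜ b), []⟩,
    ⟨qa *ₜ (qb *ₜ z), .quote (a *ₜ b) *ₜ z, []⟩,
    ⟨x *ₜ (y +ₜ z), (x *ₜ y) +ₜ (x *ₜ z), []⟩,
    ⟨(y +ₜ z) *ₜ x, (y *ₜ x) +ₜ (z *ₜ x), []⟩,
    -- exponentiation
    ⟨(x ^ₜ y) ^ₜ z, x ^ₜ (y *ₜ z), []⟩,
    ⟨(x ^ₜ y) *ₜ (x ^ₜ z), x ^ₜ (y +ₜ z), []⟩,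
    ⟨(x ^ₜ y) *ₜ ((x ^ₜ z) *ₜ v), (x ^ₜ (y +ₜ z)) *ₜ v, []⟩,
    ⟨qa ^ₜ qb, .quote (a ^ₜ b), []⟩,
    ⟨pwrN x (qn 0), qn 1, []⟩,
    ⟨pwrN x (s y), x *ₜ pwrN x y, []⟩,
    ⟨(x +ₜ y) ^ₜ qn 1, x +ₜ y, []⟩,
    ⟨(x *ₜ y) ^ₜ qa, (x ^ₜ qa) *ₜ (y ^ₜ qa), []⟩,
    ⟨x ^ₜ qn 0, qn 1, []⟩,
    -- trigonometry
    ⟨sin (qn (-1) *ₜ x), qn (-1) *ₜ sin x, []⟩,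
    ⟨cos (qn (-1) *ₜ x), cos x, []⟩,
    ⟨sin (x +ₜ y), (sin x *ₜ cos y) +ₜ (cos x *ₜ sin y), []⟩,
    ⟨cos (x +ₜ y), (cos x *ₜ cos y) +ₜ ((qn (-1) *ₜ sin x) *ₜ sin y), []⟩,
    ⟨cosN (s (s y)) x,
      (qn 2 *ₜ (cos x *ₜ cosN (s y) x)) +ₜ (qn (-1) *ₜ cosN y x), []⟩,
    ⟨sinN (s (s y)) x,
      ((qn 2 *ₜ cos x) *ₜ sinN (s y) x) +ₜ (qn (-1) *ₜ sinN y x), []⟩,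
    ⟨sin x ^ₜ qn 2, qn 1 +ₜ (qn (-1) *ₜ (cos x ^ₜ qn 2)), []⟩,
    ⟨cosN (s (qn 0)) x, cos (qn 1 *ₜ x), []⟩,
    ⟨cosN (qn 0) x, cos (qn 0), []⟩,
    ⟨sinN (s (qn 0)) x, sin (qn 1 *ₜ x), []⟩,
    ⟨sinN (qn 0) x, sin (qn 0), []⟩,
    ⟨sin qa, .quote (sin a), []⟩,
    ⟨cos qa, .quote (cos a), []⟩ ]

/-- The rule system Simp; variables are named as in `canon`. -/
def simpRules : List (Rule P) :=
  let x : Term P := .var 0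
  let y : Term P := .var 1
  let z : Term P := .var 2
  let a : Term P := .var 4
  let b : Term P := .var 5
  let qa : Term P := qv 4
  let qb : Term P := qv 5
  [ ⟨(qa *ₜ x) +ₜ (qb *ₜ y), (qb *ₜ y) +ₜ (qa *ₜ x), [(x, y)]⟩,
    ⟨(qa *ₜ x) +ₜ ((qb *ₜ y) +ₜ z), (qb *ₜ y) +ₜ ((qa *ₜ x) +ₜ z), [(x, y)]⟩,
    ⟨(qa *ₜ x) +ₜ (qb *ₜ x), .quote (a +ₜ b) *ₜ x, []⟩,
    ⟨(qa *ₜ x) +ₜ ((qb *ₜ x) +ₜ z), (.quote (a +ₜ b) *ₜ x) +ₜ z, []⟩ ]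

end Systems

end ARI

/-! The weighted path ordering does not orient every rule: if `x` has weight 1, then `pwrN x (s n) →
x × pwrN x n` raises the weight. It therefore serves only as the second component of a lexicographic
measure (`wellFounded_decreasing`). The first component is an auxiliary interpretation `size`,
strictly monotone in every argument.

Most rules strictly lower `size`. It is kept by associativity, commutativity and left-commutativity
of `+` and `×`, by the distribution of a quoted exponent over a product, and by the two sorting
rules of Simp; these all decrease in the path ordering (`canon_oriented`, `simpRules_oriented`).
Both components are compatible with contexts, so every rewrite step decreases the pair
(`Step.decreasing`).

Neither component sees the content of a quoted term: `size` counts it as 1, and the path ordering is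
applied after `erase`. This is why `κ` may be arbitrary.

Well-foundedness of the path ordering (`wellFounded_awpo`) is proved by showing that accessibility
passes from the arguments of a term to the term, without transitivity of the ordering. -/

namespace ARI

/-! ### Forgetting the contents of quoted terms. -/

section Erasure

variable {P : Type*}

/-- Replace the content of every quoted term by a fixed number. -/
def Term.erase : Term P → Term P := Term.simplify fun _ => .num (.ofInt 0)

@[simp] theorem Term.erase_var (x : ℕ) : (Term.var x : Term P).erase = .var x := rfl
@[simp] theorem Term.erase_quote (t : Term P) :
    (Term.quote t).erase = .quote (.num (.ofInt 0)) := rfl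
@[simp] theorem Term.erase_un (f : UnOp) (t : Term P) :
    (Term.un f t).erase = .un f t.erase := rfl
@[simp] theorem Term.erase_bin (g : BinOp) (s t : Term P) :
    (Term.bin g s t).erase = .bin g s.erase t.erase := rfl

@[simp] theorem Term.erase_simplify (κ : Term P → Term P) (t : Term P) :
    (t.simplify κ).erase = t.erase := by
  induction t <;> simp_all [Term.simplify]

@[simp] theorem Term.head_erase (t : Term P) : t.erase.head = t.head := by
  cases t <;> rfl

theorem Term.args_erase (σ : Status) (t : Term P) :
    t.erase.args σ = (t.args σ).map Term.erase := by
  cases t with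
  | bin g s t => by_cases h : σ g <;> simp [Term.args, h]
  | _ => rfl

@[simp] theorem weight_erase (d : ℕ → ℕ → ℕ) (α : ℕ → ℕ) (t : Term P) :
    weight d α t.erase = weight d α t := by
  induction t with
  | un f t ih => cases f <;> simp_all [weight]
  | bin g s t ihs iht => cases g <;> simp_all [weight]
  | _ => rfl

/-- Weights, root symbols and argument lists commute with erasure. Contents matter only in the
syntactic equality of `sub_eq`, and erasure preserves equalities. This carries the rule constraints,
evaluated on unerased terms, over to erased ones. -/
theorem AWPO.erase [LinearOrder P] {d : ℕ → ℕ → ℕ} {X : List ℕ} {σ : Status} {s t : Term P}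
    (h : AWPO d X σ s t) : AWPO d X σ s.erase t.erase := by
  induction h with
  | weight h => exact .weight fun α hα => by simpa using h α hα
  | sub_eq h hm =>
    exact .sub_eq (fun α hα => by simpa using h α hα)
      (by rw [Term.args_erase]; exact List.mem_map_of_mem hm)
  | sub_gt h hm _ ih =>
    exact .sub_gt (fun α hα => by simpa using h α hα)
      (by rw [Term.args_erase]; exact List.mem_map_of_mem hm) ih
  | prec h _ hp ih =>
    refine .prec (fun α hα => by simpa using h α hα) ?_ (by simpa using hp)
    simpa [Term.args_erase] using ih
  | lex h _ hh hs ht _ ih ih' =>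
    refine .lex (fun α hα => by simpa using h α hα) ?_ (by simpa using hh)
      (by rw [Term.args_erase, hs, List.map_append, List.map_cons])
      (by rw [Term.args_erase, ht, List.map_append, List.map_cons]) ih'
    simpa [Term.args_erase] using ih

end Erasure

/-! ### Positivity, simplicity and weak monotonicity of weights. -/

section Weights

variable {P : Type*} {d : ℕ → ℕ → ℕ} {X : List ℕ} {α : ℕ → ℕ}

theorem respects_one (X : List ℕ) : Respects X fun _ => 1 :=
  ⟨fun _ => one_pos, fun _ _ _ => le_rfl⟩

theorem weight_pos (hd : WeaklySimple d) (hα : ∀ x, 0 < α x) (t : Term P) :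
    0 < weight d α t := by
  induction t with
  | var x => exact hα x
  | un f t ih => cases f <;> simp [weight]
  | bin g s t ihs iht =>
    cases g <;> simp only [weight]
    case div => exact ihs.trans_le (hd _ _ ihs iht).1
    all_goals positivity
  | _ => exact one_pos

theorem weight_le_un (f : UnOp) (t : Term P) : weight d α t ≤ weight d α (.un f t) := by
  have h := (Nat.lt_two_pow_self (n := weight d α t * 3)).le
  cases f <;> simp only [weight] <;> omega

theorem weight_le_bin (hd : WeaklySimple d) (hα : ∀ x, 0 < α x) (g : BinOp) (s t : Term P) :
    weight d α s ≤ weight d α (.bin g s t) ∧ weight d α t ≤ weight d α (.bin g s t) := by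
  have hs := weight_pos hd hα s
  have ht := weight_pos hd hα t
  cases g <;> simp only [weight] <;> generalize weight d α s = a at * <;>
    generalize weight d α t = b at *
  case add => omega
  case mul => constructor <;> nlinarith
  case pow => constructor <;> nlinarith [Nat.mul_le_mul (Nat.mul_le_mul hs hs) (le_refl b),
      Nat.mul_le_mul (Nat.mul_le_mul (le_refl a) hs) ht]
  case div => exact hd _ _ hs ht
  case pwrN =>
    have h2 : b + 1 ≤ 2 ^ b := Nat.lt_two_pow_self
    constructor
    · exact (Nat.lt_pow_self (by omega)).le
    · exact (by omega : b ≤ 2 ^ b + 1).trans (Nat.le_self_pow hs.ne' _)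
  all_goals
    have h2 := (Nat.lt_two_pow_self (n := b * 3))
    constructor
    · exact (by omega : a ≤ 2 * a).trans (Nat.lt_pow_self (by omega)).le
    · exact (by omega : b ≤ 2 * 2 ^ (b * 3) + 1).trans (Nat.le_self_pow (by omega) _)

theorem weight_le_of_mem_args (hd : WeaklySimple d) (hα : ∀ x, 0 < α x) {σ : Status}
    {s t : Term P} (h : t ∈ s.args σ) : weight d α t ≤ weight d α s := by
  cases s with
  | un f s => obtain rfl := List.mem_singleton.1 h; exact weight_le_un f t
  | bin g s u =>
    have := weight_le_bin hd hα g s u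
    have h' : t = s ∨ t = u := by
      by_cases hg : σ g <;> simp [Term.args, hg] at h <;> tauto
    rcases h' with rfl | rfl <;> tauto
  | _ => simp [Term.args] at h

theorem WeightGE.un {s t : Term P} (f : UnOp) (h : WeightGE d X s t) :
    WeightGE d X (.un f s) (.un f t) := by
  intro α hα
  have := h α hα
  cases f <;> simp only [weight] <;> gcongr <;> norm_num

theorem WeightGE.bin (hm : WeaklyMonotone d) (hd : WeaklySimple d) {s s' t t' : Term P}
    (g : BinOp) (hs : WeightGE d X s s') (ht : WeightGE d X t t') :
    WeightGE d X (.bin g s t) (.bin g s' t') := by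
  intro α hα
  have h1 := hs α hα
  have h2 := ht α hα
  have p1 := weight_pos hd hα.1 s'
  have p2 := weight_pos hd hα.1 t'
  cases g <;> simp only [weight]
  case div => exact hm _ _ _ _ p1 p2 h1 h2
  case add => gcongr
  case mul => gcongr
  case pow => gcongr
  all_goals
    refine (Nat.pow_le_pow_left ?_ _).trans (Nat.pow_le_pow_right (by positivity) ?_)
    all_goals gcongr
    all_goals norm_num

theorem AWPO.weightGE [LinearOrder P] {σ : Status} {s t : Term P} (h : AWPO d X σ s t) :
    WeightGE d X s t := by
  cases h with
  | weight h => exact fun α hα => (h α hα).le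
  | _ => assumption

end Weights

/-! ### Argument lists under a status. -/

section Arguments

variable {P : Type*} {σ : Status}

theorem mem_args_bin_left (g : BinOp) (s t : Term P) : s ∈ (Term.bin g s t).args σ := by
  by_cases h : σ g <;> simp [Term.args, h]

theorem mem_args_bin_right (g : BinOp) (s t : Term P) : t ∈ (Term.bin g s t).args σ := by
  by_cases h : σ g <;> simp [Term.args, h]

theorem forall_mem_args_bin {g : BinOp} {s t : Term P} {p : Term P → Prop} (hs : p s) (ht : p t) :
    ∀ v ∈ (Term.bin g s t).args σ, p v := by
  by_cases h : σ g <;> simp [Term.args, h, hs, ht]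

theorem length_args_eq {s t : Term P} (h : s.head = t.head) :
    (s.args σ).length = (t.args σ).length := by
  cases s <;> cases t <;> simp [Term.head] at h <;> simp [Term.args]
  split_ifs <;> rfl

end Arguments

/-! ### Subterm property and closure of the path ordering under contexts. -/

section Contexts

variable {P : Type*} [LinearOrder P] {d : ℕ → ℕ → ℕ} {X : List ℕ} {σ : Status}

theorem AWPO.of_mem (hd : WeaklySimple d) {s t : Term P} (h : t ∈ s.args σ) : AWPO d X σ s t :=
  .sub_eq (fun _ hα => weight_le_of_mem_args hd hα.1 h) h

theorem AWPO.of_mem_gt (hd : WeaklySimple d) {s u t : Term P} (h : u ∈ s.args σ)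
    (hu : AWPO d X σ u t) : AWPO d X σ s t :=
  .sub_gt (fun α hα => (hu.weightGE α hα).trans (weight_le_of_mem_args hd hα.1 h)) h hu

/-- The decrease of the first compared argument already puts the whole left term above `s'`, so only
`t'` remains to be dominated. -/
theorem AWPO.bin_lex_left (hd : WeaklySimple d) {g : BinOp} {s s' t t' : Term P}
    (hg : σ g = false) (hw : WeightGE d X (.bin g s t) (.bin g s' t')) (hs : AWPO d X σ s s')
    (ht : AWPO d X σ (.bin g s t) t') : AWPO d X σ (.bin g s t) (.bin g s' t') :=
  .lex (l := []) (l₁ := [t]) (l₂ := [t']) hw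
    (forall_mem_args_bin (.of_mem_gt hd (mem_args_bin_left g s t) hs) ht) rfl
    (by simp [Term.args, hg]) (by simp [Term.args, hg]) hs

theorem AWPO.bin_lex_right (hd : WeaklySimple d) {g : BinOp} {s s' t t' : Term P}
    (hg : σ g = true) (hw : WeightGE d X (.bin g s t) (.bin g s' t')) (ht : AWPO d X σ t t')
    (hs : AWPO d X σ (.bin g s t) s') : AWPO d X σ (.bin g s t) (.bin g s' t') :=
  .lex (l := []) (l₁ := [s]) (l₂ := [s']) hw
    (forall_mem_args_bin hs (.of_mem_gt hd (mem_args_bin_right g s t) ht)) rfl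
    (by simp [Term.args, hg]) (by simp [Term.args, hg]) ht

theorem AWPO.un (hd : WeaklySimple d) (f : UnOp) {s t : Term P} (h : AWPO d X σ s t) :
    AWPO d X σ (.un f s) (.un f t) :=
  .lex (l := []) (h.weightGE.un f)
    (by simpa [Term.args] using AWPO.of_mem_gt hd (by simp [Term.args]) h) rfl rfl rfl h

/-- The status is irrelevant: the changed argument is either compared first or preceded by the
common argument `t`. -/
theorem AWPO.left (hm : WeaklyMonotone d) (hd : WeaklySimple d) (g : BinOp) {s s' : Term P}
    (t : Term P) (h : AWPO d X σ s s') : AWPO d X σ (.bin g s t) (.bin g s' t) := by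
  have hw := h.weightGE.bin hm hd g (s := s) (t := t) (t' := t) fun _ _ => le_rfl
  have hv : ∀ v ∈ (Term.bin g s' t).args σ, AWPO d X σ (.bin g s t) v :=
    forall_mem_args_bin (.of_mem_gt hd (mem_args_bin_left g s t) h)
      (.of_mem hd (mem_args_bin_right g s t))
  cases hg : σ g
  · exact .lex (l := []) (l₁ := [t]) (l₂ := [t]) hw hv rfl (by simp [Term.args, hg])
      (by simp [Term.args, hg]) h
  · exact .lex (l := [t]) (l₁ := []) (l₂ := []) hw hv rfl (by simp [Term.args, hg])
      (by simp [Term.args, hg]) h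

theorem AWPO.right (hm : WeaklyMonotone d) (hd : WeaklySimple d) (g : BinOp) (s : Term P)
    {t t' : Term P} (h : AWPO d X σ t t') : AWPO d X σ (.bin g s t) (.bin g s t') := by
  have hw := WeightGE.bin hm hd g (s := s) (s' := s) (fun _ _ => le_rfl) h.weightGE
  have hv : ∀ v ∈ (Term.bin g s t').args σ, AWPO d X σ (.bin g s t) v :=
    forall_mem_args_bin (.of_mem hd (mem_args_bin_left g s t))
      (.of_mem_gt hd (mem_args_bin_right g s t) h)
  cases hg : σ g
  · exact .lex (l := [s]) (l₁ := []) (l₂ := []) hw hv rfl (by simp [Term.args, hg])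
      (by simp [Term.args, hg]) h
  · exact .lex (l := []) (l₁ := [s]) (l₂ := [s]) hw hv rfl (by simp [Term.args, hg])
      (by simp [Term.args, hg]) h

end Contexts

/-! ### Well-foundedness of the path ordering. -/

section WellFoundedness

variable {P : Type*} [LinearOrder P]

theorem idxOf_lt_idxOf_of_sublist {X : List ℕ} (hX : X.Nodup) {x y : ℕ}
    (h : List.Sublist [x, y] X) : X.idxOf x < X.idxOf y ∧ X.idxOf y < X.length := by
  induction X with
  | nil => cases h
  | cons c X ih =>
    obtain ⟨hc, hX⟩ := List.nodup_cons.1 hX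
    cases h with
    | cons _ h =>
      have hx : c ≠ x := fun e => hc (e ▸ h.subset (by simp))
      have hy : c ≠ y := fun e => hc (e ▸ h.subset (by simp))
      simpa [List.idxOf_cons_ne _ hx, List.idxOf_cons_ne _ hy] using ih hX h
    | cons_cons _ h =>
      have hm : y ∈ X := h.subset (by simp)
      have hy : x ≠ y := fun e => hc (e ▸ hm)
      simpa [List.idxOf_cons_ne _ hy] using List.idxOf_lt_length_of_mem hm

theorem wellFounded_prec [Finite P] {X : List ℕ} (hX : X.Nodup) :
    WellFounded fun g f : Head P => Prec X f g := by
  -- Unlisted symbols get the default 0; this is harmless, since precedence by rank needs two actual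
  -- ranks. The second component separates parameters and variables, which each share one rank.
  let m : Head P → ℕ × ℕ := fun f => (f.rank.getD 0, match f with
    | .param p => (Set.Iio p).ncard
    | .var x => X.length - X.idxOf x
    | _ => 0)
  refine Subrelation.wf ?_ (InvImage.wf m (WellFounded.prod_lex wellFounded_lt wellFounded_lt))
  intro g f h
  cases h with
  | rank hf hg hlt => exact Prod.Lex.left _ _ (by simpa [hf, hg] using hlt)
  | param hlt =>
    exact Prod.Lex.right _ (Set.ncard_lt_ncard (Set.Iio_ssubset_Iio hlt) (Set.toFinite _))
  | var hs =>
    have := idxOf_lt_idxOf_of_sublist hX hs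
    exact Prod.Lex.right _ (by show _ - _ < _ - _; omega)

/-- A non-accessible `b` has no predecessors left, and an accessible one keeps at most its old ones.
This allows induction on argument lists before the ordering is known to be well-founded. -/
theorem wellFounded_acc_restrict {A : Type*} (r : A → A → Prop) :
    WellFounded fun a b => r a b ∧ Acc r b := by
  refine ⟨fun b => ?_⟩
  by_cases hb : Acc r b
  · induction hb with
    | intro b _ ih => exact ⟨b, fun a ha => ih a ha.1⟩
  · exact ⟨b, fun a ha => (hb ha.2).elim⟩

variable {d : ℕ → ℕ → ℕ} {X : List ℕ} {σ : Status}

/-- Outer induction on weight, root symbol and argument list; inner structural induction on the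
smaller term `t`, whose arguments are accessible once they lie below `s`. -/
theorem acc_of_args [Finite P] (hd : WeaklySimple d) (hX : X.Nodup) (s : Term P)
    (hs : ∀ u ∈ s.args σ, Acc (fun t s : Term P => AWPO d X σ s t) u) :
    Acc (fun t s : Term P => AWPO d X σ s t) s := by
  -- Weight comparisons hold for all respecting assignments, so this single one gives a natural
  -- number to induct on.
  have h1 := respects_one X
  have wf := InvImage.wf
    (fun s : Term P => (weight d (fun _ => 1) s, s.head, s.args σ))
    (WellFounded.prod_lex wellFounded_lt (WellFounded.prod_lex (wellFounded_prec (P := P) hX)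
      -- Plain lexicographic order on lists is not well-founded; fixing the length costs nothing,
      -- since equal roots have equally many arguments.
      (List.Shortlex.wf
        (wellFounded_acc_restrict fun t s : Term P => AWPO d X σ s t))))
  induction s using wf.induction with
  | _ s ih =>
  have key : ∀ t : Term P, (∀ u ∈ t.args σ, AWPO d X σ s u →
      Acc (fun t s : Term P => AWPO d X σ s t) u) → AWPO d X σ s t →
      Acc (fun t s : Term P => AWPO d X σ s t) t := by
    intro t iht hst
    cases hst with
    | weight h =>
      refine ih t (Prod.Lex.left _ _ (h _ h1)) fun u hu => iht u hu (.weight fun α hα => ?_)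
      exact (weight_le_of_mem_args hd hα.1 hu).trans_lt (h α hα)
    | sub_eq _ hm => exact hs t hm
    | sub_gt _ hm hu => exact (hs _ hm).inv hu
    | prec hw ha hp =>
      refine ih t ?_ fun u hu => iht u hu (ha u hu)
      rcases (hw _ h1).lt_or_eq with h | h
      · exact Prod.Lex.left _ _ h
      · show Prod.Lex _ _ (_, _) (_, _)
        rw [h]
        exact Prod.Lex.right _ (Prod.Lex.left _ _ hp)
    | @lex _ _ a b l l₁ l₂ hw ha hh es et hab =>
      refine ih t ?_ fun u hu => iht u hu (ha u hu)
      rcases (hw _ h1).lt_or_eq with h | h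
      · exact Prod.Lex.left _ _ h
      · show Prod.Lex _ _ (_, _) (_, _)
        rw [h, hh]
        refine Prod.Lex.right _ (Prod.Lex.right _
          (List.Shortlex.of_lex (length_args_eq hh.symm) ?_))
        rw [es, et]
        have hr : List.Lex (fun t s : Term P => AWPO d X σ s t ∧ Acc (fun t s => AWPO d X σ s t) s)
          (b :: l₂) (a :: l₁) := List.Lex.rel ⟨hab, hs a (by simp [es])⟩
        exact List.Lex.append_left _ hr l
  refine ⟨s, fun t => ?_⟩
  induction t with
  | un f t iht => exact key _ (by simpa [Term.args] using iht)
  | bin g t u iht ihu => exact key _ (forall_mem_args_bin iht ihu)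
  | _ => exact key _ (by simp [Term.args])

theorem wellFounded_awpo [Finite P] (hd : WeaklySimple d) (hX : X.Nodup) :
    WellFounded fun t s : Term P => AWPO d X σ s t := by
  refine ⟨fun s => ?_⟩
  induction s with
  | un f t iht => exact acc_of_args hd hX _ (by simpa [Term.args] using iht)
  | bin g t u iht ihu => exact acc_of_args hd hX _ (forall_mem_args_bin iht ihu)
  | _ => exact acc_of_args hd hX _ (by simp [Term.args])

end WellFoundedness

/-! ### The strictly monotone interpretation `size`. -/

section Size

variable {P : Type*}

/-- A strictly monotone interpretation of terms that no rule of Canon or Simp increases. -/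
def size : Term P → ℕ
  | .var _ => 1
  | .param _ => 1
  | .num _ => 1
  | .quote _ => 1
  | .un .sin t => 2 * 32 ^ size t
  | .un .cos t => 32 ^ size t
  | .un .succ t => size t + 1
  | .bin .add s t => 1 + (size s + size t)
  | .bin .mul s t => 2 * (size s * size t)
  | .bin .pow s t => 2 * (size s ^ 2 * size t)
  | .bin .div s t => size s + size t
  | .bin .sinN n x => (4 * 32 ^ size x + 3) ^ size n
  | .bin .cosN n x => (4 * 32 ^ size x + 3) ^ size n
  | .bin .pwrN x n => (2 * size x + 1) ^ size n

theorem size_pos (t : Term P) : 0 < size t := by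
  induction t with
  | un f t ih => cases f <;> simp [size]
  | bin g s t ihs iht => cases g <;> simp only [size] <;> positivity
  | _ => exact one_pos

@[simp] theorem size_simplify (κ : Term P → Term P) (t : Term P) :
    size (t.simplify κ) = size t := by
  induction t with
  | un f t ih => cases f <;> simp_all [size, Term.simplify]
  | bin g s t ihs iht => cases g <;> simp_all [size, Term.simplify]
  | _ => rfl

theorem size_un_lt (f : UnOp) {s t : Term P} (h : size t < size s) :
    size (.un f t) < size (.un f s) := by
  cases f <;> simp only [size] <;> gcongr <;> norm_num

theorem size_bin_left_lt (g : BinOp) {s s' : Term P} (t : Term P) (h : size s' < size s) :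
    size (.bin g s' t) < size (.bin g s t) := by
  have := size_pos t
  cases g <;> simp only [size] <;> gcongr
  all_goals omega

theorem size_bin_right_lt (g : BinOp) (s : Term P) {t t' : Term P} (h : size t' < size t) :
    size (.bin g s t') < size (.bin g s t) := by
  have := size_pos s
  cases g <;> simp only [size] <;> gcongr
  all_goals omega

theorem size_un_congr (f : UnOp) {s t : Term P} (h : size t = size s) :
    size (.un f t) = size (.un f s) := by
  cases f <;> simp only [size, h]

theorem size_bin_congr (g : BinOp) {s s' t t' : Term P} (hs : size s' = size s)
    (ht : size t' = size t) : size (.bin g s' t') = size (.bin g s t) := by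
  cases g <;> simp only [size, hs, ht]

end Size

/-! ### The combined measure and its decrease along rewrite steps. -/

section Termination

variable {P : Type*} [LinearOrder P]

/-- The size decreases, or it is kept and the erased terms decrease in the path ordering. -/
def Decreasing (d : ℕ → ℕ → ℕ) (X : List ℕ) (σ : Status) (s t : Term P) : Prop :=
  size t < size s ∨ size t = size s ∧ AWPO d X σ s.erase t.erase

/-- Every instance of the rule with true constraints is decreasing. -/
def Rule.Oriented (d : ℕ → ℕ → ℕ) (X : List ℕ) (σ : Status) (ρ : Rule P) : Prop :=
  ∀ δ : ℕ → Term P, (∀ c ∈ (ρ.subst δ).cond, AWPO d X σ c.1 c.2) →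
    Decreasing d X σ (ρ.lhs.subst δ) (ρ.rhs.subst δ)

variable {d : ℕ → ℕ → ℕ} {X : List ℕ} {σ : Status}

theorem wellFounded_decreasing [Finite P] (hd : WeaklySimple d) (hX : X.Nodup) :
    WellFounded fun t s : Term P => Decreasing d X σ s t := by
  refine Subrelation.wf ?_ (InvImage.wf (fun t : Term P => (size t, t.erase))
    (WellFounded.prod_lex wellFounded_lt (wellFounded_awpo (σ := σ) hd hX)))
  rintro t s (h | ⟨h, h'⟩)
  · exact Prod.Lex.left _ _ h
  · show Prod.Lex _ _ (_, _) (_, _)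
    rw [h]
    exact Prod.Lex.right _ h'

theorem Step.decreasing (hm : WeaklyMonotone d) (hd : WeaklySimple d)
    {κ : Term P → Term P} {R : List (Rule P)} (hR : ∀ ρ ∈ R, ρ.Oriented d X σ)
    {s t : Term P} (h : Step d X σ κ R s t) : Decreasing d X σ s t := by
  induction h with
  -- `size` and `erase` are both unchanged by `simplify κ`.
  | root ρ δ hρ _ hc => simpa [Decreasing] using hR ρ hρ δ hc
  | un f _ ih =>
    exact ih.imp (size_un_lt f) fun h => ⟨size_un_congr f h.1, h.2.un hd f⟩
  | left g t _ ih =>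
    exact ih.imp (size_bin_left_lt g t) fun h =>
      ⟨size_bin_congr g h.1 rfl, h.2.left hm hd g t.erase⟩
  | right g s _ ih =>
    exact ih.imp (size_bin_right_lt g s) fun h =>
      ⟨size_bin_congr g rfl h.1, h.2.right hm hd g s.erase⟩

theorem terminating_of_oriented [Finite P] (hm : WeaklyMonotone d) (hd : WeaklySimple d)
    (hX : X.Nodup) (κ : Term P → Term P) {R : List (Rule P)}
    (hR : ∀ ρ ∈ R, ρ.Oriented d X σ) : Terminating (Step d X σ κ R) := by
  rintro ⟨f, hf⟩
  exact (wellFounded_iff_isEmpty_descending_chain.1 (wellFounded_decreasing (σ := σ) hd hX)).false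
    ⟨f, fun n => (hf n).decreasing hm hd hR⟩

theorem Rule.oriented_of_size_lt {ρ : Rule P}
    (h : ∀ δ : ℕ → Term P, size (ρ.rhs.subst δ) < size (ρ.lhs.subst δ)) :
    ρ.Oriented d X σ :=
  fun δ _ => .inl (h δ)

end Termination

/-! ### Orientation of the individual rules. -/

section Orientation

variable {P : Type*} [LinearOrder P] {d : ℕ → ℕ → ℕ} {X : List ℕ}

theorem add_comm_awpo (hd : WeaklySimple d) {σ : Status} (hσ : σ .add = false) {x y : Term P}
    (h : AWPO d X σ x y) : AWPO d X σ (x +ₜ y) (y +ₜ x) :=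
  .bin_lex_left hd hσ (fun α _ => by simp only [weight]; omega) h
    (.of_mem hd (mem_args_bin_left _ _ _))

theorem add_left_comm_awpo (hd : WeaklySimple d) {σ : Status} (hσ : σ .add = false)
    {x y : Term P} (z : Term P) (h : AWPO d X σ x y) :
    AWPO d X σ (x +ₜ (y +ₜ z)) (y +ₜ (x +ₜ z)) :=
  .bin_lex_left hd hσ (fun α _ => by simp only [weight]; omega) h <| .weight fun α hα => by
    have := weight_pos hd hα.1 y
    simp only [weight]; omega

theorem add_assoc_awpo (hd : WeaklySimple d) {σ : Status} (hσ : σ .add = false)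
    (x y z : Term P) : AWPO d X σ ((x +ₜ y) +ₜ z) (x +ₜ (y +ₜ z)) :=
  .bin_lex_left hd hσ (fun α _ => by simp only [weight]; omega)
    (.of_mem hd (mem_args_bin_left _ _ _)) <| .weight fun α hα => by
      have := weight_pos hd hα.1 x
      simp only [weight]; omega

theorem mul_comm_awpo (hd : WeaklySimple d) {σ : Status} (hσ : σ .mul = false) {x y : Term P}
    (h : AWPO d X σ x y) : AWPO d X σ (x *ₜ y) (y *ₜ x) :=
  .bin_lex_left hd hσ (fun α _ => by simp only [weight]; exact le_of_eq (by ring)) h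
    (.of_mem hd (mem_args_bin_left _ _ _))

theorem mul_left_comm_awpo (hd : WeaklySimple d) {σ : Status} (hσ : σ .mul = false)
    {x y : Term P} (z : Term P) (h : AWPO d X σ x y) :
    AWPO d X σ (x *ₜ (y *ₜ z)) (y *ₜ (x *ₜ z)) :=
  .bin_lex_left hd hσ (fun α _ => by simp only [weight]; exact le_of_eq (by ring)) h <|
    .weight fun α hα => by
      have hx := weight_pos hd hα.1 x
      have hy := weight_pos hd hα.1 y
      have hz := weight_pos hd hα.1 z
      simp only [weight]
      nlinarith [Nat.mul_pos hx hz, Nat.mul_le_mul_right (weight d α x * weight d α z) hy]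

theorem mul_assoc_awpo (hd : WeaklySimple d) {σ : Status} (hσ : σ .mul = false)
    (x y z : Term P) : AWPO d X σ ((x *ₜ y) *ₜ z) (x *ₜ (y *ₜ z)) :=
  .bin_lex_left hd hσ (fun α _ => by simp only [weight]; exact le_of_eq (by ring))
    (.of_mem hd (mem_args_bin_left _ _ _)) <| .weight fun α hα => by
      have hx := weight_pos hd hα.1 x
      have hy := weight_pos hd hα.1 y
      have hz := weight_pos hd hα.1 z
      simp only [weight]
      nlinarith [Nat.mul_pos hy hz, Nat.mul_le_mul_right (weight d α y * weight d α z) hx]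

/-- The quoted exponent has weight 1, so both sides weigh the same and the precedence of `^` over
`×` decides; each factor on the right is strictly lighter than the left side. -/
theorem mul_pow_awpo (hd : WeaklySimple d) (σ : Status) (x y u : Term P) :
    AWPO d X σ ((x *ₜ y) ^ₜ .quote u) ((x ^ₜ .quote u) *ₜ (y ^ₜ .quote u)) := by
  have aux : ∀ a b : ℕ, 0 < a → 0 < b →
      a * a * (2 * 1) < 2 * (a * b) * (2 * (a * b)) * (2 * 1) := by
    intro a b ha hb
    have h1 : 0 < a * a := Nat.mul_pos ha ha
    have h2 : 0 < b * b := Nat.mul_pos hb hb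
    nlinarith [Nat.mul_le_mul_left (a * a) h2]
  refine .prec (fun α _ => ?_) (forall_mem_args_bin (.weight fun α hα => ?_)
    (.weight fun α hα => ?_)) (.rank (m := 5) (n := 4) rfl rfl (by norm_num))
  · simp only [weight]; exact le_of_eq (by ring)
  · exact aux _ _ (weight_pos hd hα.1 x) (weight_pos hd hα.1 y)
  · have := aux _ _ (weight_pos hd hα.1 y) (weight_pos hd hα.1 x)
    simp only [weight]
    rwa [mul_comm (weight d α x)]

/-- Right-to-left status compares `x` with `y` before the coefficients, which therefore play no
role. -/
theorem mul_quote_awpo (hd : WeaklySimple d) {x y : Term P} (u v : Term P)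
    (h : AWPO d X mulRightToLeft x y) :
    AWPO d X mulRightToLeft (.quote u *ₜ x) (.quote v *ₜ y) :=
  .bin_lex_right hd rfl
    (fun α hα => by have := h.weightGE α hα; simp only [weight]; omega) h
    (.weight fun α hα => by have := weight_pos hd hα.1 x; simp only [weight]; omega)

/-- Here `p` is the square of the size of the base. -/
theorem pow_add_lt {p y z : ℕ} (hp : 0 < p) (hy : 0 < y) (hz : 0 < z) :
    2 * (p * (1 + (y + z))) < 2 * (2 * (p * y) * (2 * (p * z))) := by
  have h : 1 + (y + z) ≤ 3 * (y * z) := by nlinarith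
  have hyz : 0 < p * (y * z) := by positivity
  calc 2 * (p * (1 + (y + z))) ≤ 2 * (p * (3 * (y * z))) := by gcongr
    _ < 8 * (1 * (p * (y * z))) := by linarith
    _ ≤ 8 * (p * (p * (y * z))) := by gcongr; exact hp
    _ = 2 * (2 * (p * y) * (2 * (p * z))) := by ring

/-- With `q = 4a + 3`, the recurrences for `cosN` and `sinN` need `q² > 4aq + 3`, and indeed `q² -
4aq = 3q`. -/
theorem chebyshev_lt (a : ℕ) (ha : 0 < a) (n : ℕ) :
    1 + (2 * (1 * (2 * (a * (4 * a + 3) ^ (n + 1)))) + 2 * (1 * (4 * a + 3) ^ n)) <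
      (4 * a + 3) ^ (n + 1 + 1) := by
  have hk : 0 < (4 * a + 3) ^ n := by positivity
  simp only [pow_succ]
  generalize (4 * a + 3) ^ n = k at *
  nlinarith [Nat.mul_pos ha hk]

/-- The addition rule for `cos` compares `32ab` with `1 + 18ab`, so base 16 would be too small. The
factor 2 in the size of `sin` serves the rule for `sin x ^ [2]`, comparing `8a²` with `2 + 4a²`. -/
theorem canon_oriented (hd : WeaklySimple d) :
    ∀ ρ ∈ canon (P := P), ρ.Oriented d X leftToRight := by
  simp only [canon, List.forall_mem_cons, List.not_mem_nil, IsEmpty.forall_iff, implies_true,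
    and_true]
  refine ⟨?_, ?_, ?_, ?_, ?_, ?_, ?_, ?_, ?_, ?_, ?_, ?_, ?_, ?_, ?_, ?_, ?_, ?_, ?_, ?_, ?_, ?_,
    ?_, ?_, ?_, ?_, ?_, ?_, ?_, ?_, ?_, ?_, ?_, ?_, ?_, ?_, ?_, ?_⟩
  case refine_1 =>
    exact fun δ _ => .inr ⟨by simp only [Term.subst, size]; omega, add_assoc_awpo hd rfl _ _ _⟩
  case refine_2 =>
    exact fun δ hc => .inr ⟨by simp only [Term.subst, size]; omega,
      add_comm_awpo hd rfl (hc _ (List.mem_singleton_self _)).erase⟩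
  case refine_3 =>
    exact fun δ hc => .inr ⟨by simp only [Term.subst, size]; omega,
      add_left_comm_awpo hd rfl _ (hc _ (List.mem_singleton_self _)).erase⟩
  case refine_9 =>
    exact fun δ _ => .inr ⟨by simp only [Term.subst, size]; ring, mul_assoc_awpo hd rfl _ _ _⟩
  case refine_10 =>
    exact fun δ hc => .inr ⟨by simp only [Term.subst, size]; ring,
      mul_comm_awpo hd rfl (hc _ (List.mem_singleton_self _)).erase⟩
  case refine_11 =>
    exact fun δ hc => .inr ⟨by simp only [Term.subst, size]; ring,
      mul_left_comm_awpo hd rfl _ (hc _ (List.mem_singleton_self _)).erase⟩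
  case refine_24 =>
    exact fun δ _ => .inr ⟨by simp only [Term.subst, size, qv]; ring, mul_pow_awpo hd _ _ _ _⟩
  -- All remaining rules lower `size`; `δ 4` and `δ 5` occur only inside quotes and drop out.
  all_goals
    refine Rule.oriented_of_size_lt fun δ => ?_
    have h0 := size_pos (δ 0)
    have h1 := size_pos (δ 1)
    have h2 := size_pos (δ 2)
    have h3 := size_pos (δ 3)
    simp only [Term.subst, size, qn, qv]
    generalize size (δ 0) = x at *
    generalize size (δ 1) = y at *
    generalize size (δ 2) = z at *
    generalize size (δ 3) = v at *
    try omega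
  case refine_15 => nlinarith
  case refine_16 => nlinarith
  case refine_17 =>
    have hq : 0 < x ^ 2 * y := by positivity
    have hr : 0 < x ^ 2 * y * z := by positivity
    nlinarith [Nat.mul_le_mul_right (x ^ 2 * y * z) hq]
  case refine_18 =>
    have hp : 0 < x ^ 2 := by positivity
    have := pow_add_lt hp h1 h2
    linarith
  case refine_19 =>
    have hp : 0 < x ^ 2 := by positivity
    have := Nat.mul_lt_mul_of_pos_right (pow_add_lt hp h1 h2) h3
    nlinarith
  case refine_21 => rw [pow_one]; omega
  case refine_22 =>
    have : 0 < (2 * x + 1) ^ y := by positivity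
    rw [pow_succ]
    linarith
  case refine_23 => nlinarith
  case refine_25 => nlinarith
  case refine_30 => exact chebyshev_lt (32 ^ x) (by positivity) y
  case refine_31 => linarith [chebyshev_lt (32 ^ x) (by positivity) y]
  -- Splitting exponents leaves polynomial inequalities in `a = 32 ^ x` and `b = 32 ^ y`, both at
  -- least 32.
  all_goals
    have hx : 32 ≤ 32 ^ x := Nat.le_self_pow h0.ne' 32
    try have hy : 32 ≤ 32 ^ y := Nat.le_self_pow h1.ne' 32
    try simp only [one_mul, pow_add, pow_one, two_mul x]
    generalize 32 ^ x = a at *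
    generalize 32 ^ y = b at *
    nlinarith

theorem simpRules_oriented (hd : WeaklySimple d) :
    ∀ ρ ∈ simpRules (P := P), ρ.Oriented d X mulRightToLeft := by
  simp only [simpRules, List.forall_mem_cons, List.not_mem_nil, IsEmpty.forall_iff, implies_true,
    and_true]
  refine ⟨fun δ hc => .inr ⟨?_, add_comm_awpo hd rfl
      (mul_quote_awpo hd _ _ (hc _ (List.mem_singleton_self _)).erase)⟩,
    fun δ hc => .inr ⟨?_, add_left_comm_awpo hd rfl _
      (mul_quote_awpo hd _ _ (hc _ (List.mem_singleton_self _)).erase)⟩,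
    Rule.oriented_of_size_lt fun δ => ?_, Rule.oriented_of_size_lt fun δ => ?_⟩
  all_goals
    have := size_pos (δ 0)
    simp only [Term.subst, size, qv]
    omega

end Orientation
end ARI

theorem mainTheorem2 {P : Type*} [Finite P] [LinearOrder P]
    (d : ℕ → ℕ → ℕ) (hd_mono : ARI.WeaklyMonotone d) (hd_simple : ARI.WeaklySimple d)
    (X : List ℕ) (hX : X.Nodup) (κ : ARI.Term P → ARI.Term P) :
    ARI.Terminating (ARI.Step d X ARI.leftToRight κ ARI.canon) ∧
      ARI.Terminating (ARI.Step d X ARI.mulRightToLeft κ ARI.simpRules) :=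
  ⟨ARI.terminating_of_oriented hd_mono hd_simple hX κ (ARI.canon_oriented hd_simple),
    ARI.terminating_of_oriented hd_mono hd_simple hX κ (ARI.simpRules_oriented hd_simple)⟩
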